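/- Let $D$ be an integral domain with quotient field $K$. An overring of $D$ is a ring $A$ with $D\subseteq A\subseteq K$. For such $A$ let $\operatorname{Int}(D,A)=\{f\in K[X] : f(D)\subseteq A\}$ and $\operatorname{Int}(A)=\{f\in K[X] : f(A)\subseteq A\}$; $A$ is a polynomially regular extension of $D$ if $\operatorname{Int}(D,A)$ is generated by $\operatorname{Int}(D)$ as an $A$-module. For a multiplicative subset $S$ of $D$ with $0\notin S$ we view $S^{-1}D\subseteq K$ and $S^{-1}\operatorname{Int}(D)=\{s^{-1}g : s\in S,\ g\in\operatorname{Int}(D)\}\subseteq K[X]$; if $S=D\setminus\mathfrak p$ for a prime ideal $\mathfrak p$, these are written $D_{\mathfrak p}$ and $\operatorname{Int}(D)_{\mathfrak p}$. The residue field of $\mathfrak p$ is $D_{\mathfrak p}/\mathfrak pD_{\mathfrak p}$. For a domain $R$ with quotient field $K$ and a nonzero fractional ideal $I$ of $R$, put $I^{-1}=\{x\in K : xI\subseteq R\}$ and $I_t=\bigcup_J (J^{-1})^{-1}$, where $J$ ranges over the nonzero finitely generated fractional ideals contained in $I$. A $t$-ideal is a nonzero fractional ideal $I$ with $I=I_t$;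 an ideal of $R$ is $t$-maximal if it is maximal among the $t$-ideals properly contained in $R$. A prime $\mathfrak p$ of $D$ is $t$-localizing if $\mathfrak pD_{\mathfrak p}$ is a $t$-ideal of $D_{\mathfrak p}$, and a weak int prime if $\operatorname{Int}(D_{\mathfrak p})\neq D_{\mathfrak p}[X]$. A prime of $R$ is a weakly associated prime of an $R$-module $M$ if it is minimal among the primes containing the annihilator of some element of $M$. Then the following conditions are equivalent. 1. Every overring of $D$ that is flat as a $D$-module is a polynomially regular extension of $D$. 2. $\operatorname{Int}(S^{-1}D)=S^{-1}\operatorname{Int}(D)$ for every multiplicative subset $S$ of $D$ with $0\notin S$. 3. $\operatorname{Int}(D_{\mathfrak p})=\operatorname{Int}(D)_{\mathfrak p}$ for every prime ideal $\mathfrak p$ of $D$. 4. $\operatorname{Int}(D_{\mathfrak p})=\operatorname{Int}(D)_{\mathfrak p}$ for every $t$-localizing $t$-maximal ideal $\mathfrak p$ of $D$ with finite residue field. 5. $\operatorname{Int}(D_{\mathfrak p})=\operatorname{Int}(D)_{\mathfrak p}$ for every prime ideal $\mathfrak p$ of $D$ with finite residue field such that $\mathfrak pD_{\mathfrak p}$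 is a weakly associated prime of the $D_{\mathfrak p}$-module $K/D_{\mathfrak p}$. 6. $\operatorname{Int}(D_{\mathfrak p})=\operatorname{Int}(D)_{\mathfrak p}$ for every weak int prime $\mathfrak p$ of $D$. -/

import Mathlib

open scoped nonZeroDivisors Polynomial

noncomputable section

namespace IntPoly

section Ideals

variable (R : Type*) [CommRing R] [IsDomain R] (K : Type*) [Field K] [Algebra R K]
  [IsFractionRing R K]

/-- The `v`-closure `J_v = (J⁻¹)⁻¹` of a fractional ideal `J`, where `J⁻¹ = (R :_K J)`. It is the
usual notion for nonzero `J`, and is only used for such `J`. -/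
def vClosure (J : FractionalIdeal R⁰ K) : FractionalIdeal R⁰ K := (J⁻¹)⁻¹

/-- The `t`-closure `I_t = ⋃ J_v`, where `J` ranges over the nonzero finitely generated fractional
ideals contained in `I`. -/
def tClosure (I : FractionalIdeal R⁰ K) : Set K :=
  {x | ∃ J : FractionalIdeal R⁰ K, J ≠ 0 ∧ (J : Submodule R K).FG ∧ J ≤ I ∧ x ∈ vClosure R K J}

/-- A `t`-ideal is a nonzero fractional ideal `I` with `I = I_t`. -/
def IsTFractionalIdeal (I : FractionalIdeal R⁰ K) : Prop :=
  I ≠ 0 ∧ tClosure R K I = {x | x ∈ I}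

/-- An ideal of `R` that is a `t`-ideal. -/
def IsTIdeal (I : Ideal R) : Prop :=
  IsTFractionalIdeal R K (I : FractionalIdeal R⁰ K)

/-- A `t`-maximal ideal is an ideal that is maximal among the `t`-ideals properly contained
in `R`. -/
def IsTMaximal (I : Ideal R) : Prop :=
  Maximal (fun J : Ideal R => IsTIdeal R K J ∧ J ≠ ⊤) I

end Ideals

/-- A prime ideal is a weakly associated prime of the module `M` if it is minimal among the prime
ideals containing the annihilator of some element of `M`. -/
def IsWeaklyAssociatedPrime (R : Type*) [CommRing R] (M : Type*) [AddCommGroup M] [Module R M]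
    (q : Ideal R) : Prop :=
  ∃ m : M, q ∈ (Submodule.span R {m}).annihilator.minimalPrimes

section IntegerValued

variable {D : Type*} [CommRing D] [IsDomain D] {K : Type*} [Field K] [Algebra D K]
  [IsFractionRing D K]

/-- `Int(E, A) = {f ∈ K[X] : f(E) ⊆ A}` for a subset `E` of `K` and an overring `A` of `D`, that
is, a ring between `D` and its quotient field `K` (which is also the quotient field of `A`). -/
def IntOn (E : Set K) (A : Subalgebra D K) : Subalgebra D K[X] where
  carrier := {f | ∀ a ∈ E, f.eval a ∈ A}
  mul_mem' hf hg a ha := by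
    rw [Polynomial.eval_mul]; exact A.mul_mem (hf a ha) (hg a ha)
  add_mem' hf hg a ha := by
    rw [Polynomial.eval_add]; exact A.add_mem (hf a ha) (hg a ha)
  algebraMap_mem' r a _ := by
    simp [Polynomial.algebraMap_apply]

/-- `Int(A) = Int(A, A)`, the ring of integer-valued polynomials on the overring `A` of `D`.
The ring `D` itself, viewed inside `K`, is the overring `⊥`. -/
def IntRing (A : Subalgebra D K) : Subalgebra D K[X] := IntOn (A : Set K) A

/-- The overring `A` of `D` is a polynomially regular extension of `D` if `Int(D, A)` is generated
by `Int(D)` as an `A`-module. -/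
def IsPolynomiallyRegular (A : Subalgebra D K) : Prop :=
  (Submodule.span A (IntRing (⊥ : Subalgebra D K) : Set K[X]) : Set K[X]) =
    (IntOn ((⊥ : Subalgebra D K) : Set K) A : Set K[X])

/-- `S⁻¹B = {s⁻¹ g : s ∈ S, g ∈ B}` inside `K[X]`, for a `D`-subalgebra `B` of `K[X]` and a
multiplicative subset `S` of `D` that does not contain zero. -/
def fractionsIn (S : Submonoid D) (hS : S ≤ D⁰) (B : Subalgebra D K[X]) : Subalgebra D K[X] where
  carrier := {f | ∃ s ∈ S, ∃ g ∈ B, f = (algebraMap D K s)⁻¹ • g}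
  mul_mem' := by
    rintro _ _ ⟨s, hs, g, hg, rfl⟩ ⟨t, ht, h, hh, rfl⟩
    exact ⟨s * t, S.mul_mem hs ht, g * h, B.mul_mem hg hh, by
      rw [map_mul, mul_inv, smul_mul_smul_comm]⟩
  add_mem' := by
    rintro _ _ ⟨s, hs, g, hg, rfl⟩ ⟨t, ht, h, hh, rfl⟩
    have hs0 : algebraMap D K s ≠ 0 := IsFractionRing.to_map_ne_zero_of_mem_nonZeroDivisors (hS hs)
    have ht0 : algebraMap D K t ≠ 0 := IsFractionRing.to_map_ne_zero_of_mem_nonZeroDivisors (hS ht)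
    refine ⟨s * t, S.mul_mem hs ht, t • g + s • h,
      B.add_mem (B.smul_mem hg t) (B.smul_mem hh s), ?_⟩
    rw [smul_add, ← algebraMap_smul K t g, ← algebraMap_smul K s h, smul_smul, smul_smul, map_mul]
    congr 2 <;> field_simp
  algebraMap_mem' r := ⟨1, S.one_mem, algebraMap D K[X] r, B.algebraMap_mem r, by simp⟩

/-- `S⁻¹D` as an overring of `D`. -/
abbrev locOverring (K : Type*) [Field K] [Algebra D K] [IsFractionRing D K]
    (S : Submonoid D) (hS : S ≤ D⁰) : Subalgebra D K :=
  Localization.subalgebra.ofField K S hS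

/-- `D_𝔭` as an overring of `D`. -/
abbrev locAt (K : Type*) [Field K] [Algebra D K] [IsFractionRing D K]
    (p : Ideal D) [p.IsPrime] : Subalgebra D K :=
  locOverring K p.primeCompl p.primeCompl_le_nonZeroDivisors

/-- The ideal `𝔭D_𝔭` of `D_𝔭`. -/
abbrev primeAt (K : Type*) [Field K] [Algebra D K] [IsFractionRing D K]
    (p : Ideal D) [p.IsPrime] : Ideal (locAt K p) :=
  p.map (algebraMap D (locAt K p))

/-- The equality `Int(D_𝔭) = Int(D)_𝔭` of subrings of `K[X]`. -/
def IntLocalizesAt (K : Type*) [Field K] [Algebra D K] [IsFractionRing D K]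
    (p : Ideal D) [p.IsPrime] : Prop :=
  IntRing (locAt K p) =
    fractionsIn p.primeCompl p.primeCompl_le_nonZeroDivisors (IntRing (⊥ : Subalgebra D K))

/-- A prime `𝔭` of `D` is `t`-localizing if `𝔭D_𝔭` is a `t`-ideal of `D_𝔭`. -/
def IsTLocalizing (K : Type*) [Field K] [Algebra D K] [IsFractionRing D K]
    (p : Ideal D) [p.IsPrime] : Prop :=
  IsTIdeal (locAt K p) K (primeAt K p)

/-- A prime `𝔭` of `D` is a weak int prime if `Int(D_𝔭) ≠ D_𝔭[X]`. -/
def IsWeakIntPrime (K : Type*) [Field K] [Algebra D K] [IsFractionRing D K]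
    (p : Ideal D) [p.IsPrime] : Prop :=
  IntRing (locAt K p) ≠ (Polynomial.mapAlgHom (locAt K p).val).range

end IntegerValued

end IntPoly

end

open scoped nonZeroDivisors Polynomial

set_option linter.unusedSectionVars false

namespace IntPoly

/-! ### Localization of integer-valued polynomials -/

section Localization

variable {D : Type*} [CommRing D] [IsDomain D] {K : Type*} [Field K] [Algebra D K]
  [IsFractionRing D K]

/-! The inclusion `S⁻¹Int(D) ⊆ Int(S⁻¹D)` always holds, because `Int(D, S⁻¹D) = Int(S⁻¹D)`; only the
converse is at stake.

Localization at all primes gives polynomial regularity of a flat overring `A` by a conductor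
argument. If `f ∈ Int(D, A)` is not in the span, its conductor lies in a maximal ideal `m` of `A`.
Flatness gives `A ⊆ D_p` for `p = m ∩ D`, so some `s ∉ p` has `sf ∈ Int(D)`, which puts `s` in `m`.
Conversely, localizations are flat.

The restricted conditions suffice because only weak int primes matter: if `Int(D_p) = D_p[X]`,
common denominators settle `p`. A weak int prime satisfies the hypotheses of both other conditions.
Lagrange interpolation yields a weakly associated prime of `K/D_p` with finite residue ring
(`exists_isWeaklyAssociatedPrime_finite`), which must be `pD_p`. This makes `pD_p` a `t`-ideal
(`isTIdeal_maximalIdeal`), a property that descends to `p` (`isTIdeal_of_isTLocalizing`); and `p` is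
maximal, hence `t`-maximal. -/

theorem mem_locOverring {S : Submonoid D} {hS : S ≤ D⁰} {x : K} :
    x ∈ locOverring K S hS ↔ ∃ a : D, ∃ s ∈ S, x = algebraMap D K a * (algebraMap D K s)⁻¹ := by
  constructor
  · rintro ⟨a, s, hs, h⟩
    exact ⟨a, s, hs, h⟩
  · rintro ⟨a, s, hs, h⟩
    exact ⟨a, s, hs, h⟩

theorem inv_mem_locOverring {S : Submonoid D} {hS : S ≤ D⁰} {s : D} (hs : s ∈ S) :
    (algebraMap D K s)⁻¹ ∈ locOverring K S hS :=
  mem_locOverring.2 ⟨1, s, hs, by simp⟩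

theorem algebraMap_ne_zero_of_mem {S : Submonoid D} (hS : S ≤ D⁰) {s : D} (hs : s ∈ S) :
    algebraMap D K s ≠ 0 :=
  IsFractionRing.to_map_ne_zero_of_mem_nonZeroDivisors (hS hs)

/-- Clearing the leading term: `sⁿ f - f(sX)` has degree less than `n`. -/
theorem degree_pow_mul_sub_comp_lt {f : K[X]} (hf : f.natDegree ≠ 0) (s : K) :
    (Polynomial.C (s ^ f.natDegree) * f - f.comp (Polynomial.C s * Polynomial.X)).natDegree
      < f.natDegree := by
  refine lt_of_le_of_ne ?_ ?_
  · refine (Polynomial.natDegree_sub_le _ _).trans (max_le ?_ ?_)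
    · exact Polynomial.natDegree_C_mul_le _ _
    · refine Polynomial.natDegree_comp_le.trans ?_
      exact (Nat.mul_le_mul_left _ ((Polynomial.natDegree_C_mul_le _ _).trans
        Polynomial.natDegree_X_le)).trans_eq (mul_one _)
  -- Both terms have the same coefficient in degree `n`, so degree exactly `n` would force the
  -- difference to vanish, and `n = 0`.
  · intro h
    have h0 := Polynomial.leadingCoeff_eq_zero (p := Polynomial.C (s ^ f.natDegree) * f
      - f.comp (Polynomial.C s * Polynomial.X))
    rw [Polynomial.leadingCoeff, h, Polynomial.coeff_sub, Polynomial.coeff_C_mul,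
      Polynomial.comp_C_mul_X_coeff, mul_comm, sub_self] at h0
    have := h0.1 rfl
    rw [this] at h
    exact hf h.symm

/-- At `a/s`, induction on the degree applies to `g = sⁿf - f(sX)`, and `sⁿf(a/s) = g(a/s) + f(a)`.
-/
theorem mem_intRing_of_mem_intOn_bot {S : Submonoid D} {hS : S ≤ D⁰} (n : ℕ) :
    ∀ f : K[X], f.natDegree ≤ n → f ∈ IntOn ((⊥ : Subalgebra D K) : Set K) (locOverring K S hS) →
      f ∈ IntRing (locOverring K S hS) := by
  induction n with
  | zero =>
    intro f hf h x _
    rw [Polynomial.eq_C_of_natDegree_le_zero hf] at h ⊢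
    simpa using h 0 (zero_mem _)
  | succ n ih =>
    intro f hf h x hx
    by_cases h0 : f.natDegree = 0
    · rw [Polynomial.eq_C_of_natDegree_eq_zero h0] at h ⊢
      simpa using h 0 (zero_mem _)
    obtain ⟨a, s, hs, rfl⟩ := mem_locOverring.1 hx
    have hs0 := algebraMap_ne_zero_of_mem (K := K) hS hs
    set σ := algebraMap D K s with hσ
    have hσD : σ ∈ (⊥ : Subalgebra D K) := Subalgebra.algebraMap_mem _ s
    have hlt := degree_pow_mul_sub_comp_lt h0 σ
    have hg := ih _ (Nat.le_of_lt_succ (hlt.trans_le hf)) (fun y hy => by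
      have h1 := h y hy
      have h2 := h (σ * y) ((⊥ : Subalgebra D K).mul_mem hσD hy)
      simp only [Polynomial.eval_sub, Polynomial.eval_mul, Polynomial.eval_C,
        Polynomial.eval_comp, Polynomial.eval_X]
      exact sub_mem (mul_mem (pow_mem (Subalgebra.algebraMap_mem _ s) _) h1) h2) _ hx
    have ha := h (algebraMap D K a) (Subalgebra.algebraMap_mem _ a)
    simp only [Polynomial.eval_sub, Polynomial.eval_mul, Polynomial.eval_C,
        Polynomial.eval_comp, Polynomial.eval_X] at hg
    have e : σ * (algebraMap D K a * σ⁻¹) = algebraMap D K a := by field_simp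
    rw [e] at hg
    have hsum := mul_mem (pow_mem (inv_mem_locOverring (K := K) (hS := hS) hs) f.natDegree)
      (add_mem hg ha)
    rw [sub_add_cancel, ← mul_assoc, ← mul_pow, inv_mul_cancel₀ hs0, one_pow, one_mul] at hsum
    exact hsum

theorem intOn_bot_locOverring (S : Submonoid D) (hS : S ≤ D⁰) :
    IntOn ((⊥ : Subalgebra D K) : Set K) (locOverring K S hS) = IntRing (locOverring K S hS) := by
  refine le_antisymm (fun f hf => mem_intRing_of_mem_intOn_bot _ f le_rfl hf) (fun f hf a ha => ?_)
  exact hf a ((bot_le : (⊥ : Subalgebra D K) ≤ locOverring K S hS) ha)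

theorem fractionsIn_le_intRing (S : Submonoid D) (hS : S ≤ D⁰) :
    fractionsIn S hS (IntRing (⊥ : Subalgebra D K)) ≤ IntRing (locOverring K S hS) := by
  rw [← intOn_bot_locOverring]
  rintro _ ⟨s, hs, g, hg, rfl⟩ a ha
  rw [Polynomial.eval_smul, smul_eq_mul]
  exact mul_mem (inv_mem_locOverring hs)
    ((bot_le : (⊥ : Subalgebra D K) ≤ locOverring K S hS) (hg a ha))

theorem range_mapAlgHom_le_intRing (A : Subalgebra D K) :
    (Polynomial.mapAlgHom A.val).range ≤ IntRing A := by
  rintro _ ⟨g, rfl⟩ a ha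
  have : (g.map (algebraMap A K)).eval (algebraMap A K ⟨a, ha⟩) ∈ A := by
    rw [Polynomial.eval_map_apply]
    exact (g.eval ⟨a, ha⟩).2
  exact this

theorem intLocalizesAt_iff (p : Ideal D) [p.IsPrime] :
    IntLocalizesAt K p ↔ ∀ f ∈ IntRing (locAt K p), ∃ s ∉ p,
      s • f ∈ IntRing (⊥ : Subalgebra D K) := by
  constructor
  · intro h f hf
    rw [show IntRing (locAt K p) = _ from h] at hf
    obtain ⟨s, hs, g, hg, rfl⟩ := hf
    refine ⟨s, hs, ?_⟩
    have hs0 := algebraMap_ne_zero_of_mem (K := K) p.primeCompl_le_nonZeroDivisors hs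
    rwa [← algebraMap_smul K s, smul_inv_smul₀ hs0]
  · intro h
    refine le_antisymm (fun f hf => ?_) (fractionsIn_le_intRing _ _)
    obtain ⟨s, hs, hg⟩ := h f hf
    refine ⟨s, hs, _, hg, ?_⟩
    have hs0 := algebraMap_ne_zero_of_mem (K := K) p.primeCompl_le_nonZeroDivisors
      (show s ∈ p.primeCompl from hs)
    rw [← algebraMap_smul K s, inv_smul_smul₀ hs0]

theorem intLocalizesAt_of_not_isWeakIntPrime (p : Ideal D) [p.IsPrime]
    (hp : ¬ IsWeakIntPrime K p) : IntLocalizesAt K p := by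
  refine le_antisymm ?_ (fractionsIn_le_intRing _ _)
  rw [not_not.1 hp]
  rintro _ ⟨g, rfl⟩
  induction g using Polynomial.induction_on' with
  | add g h hg hh => rw [map_add]; exact add_mem hg hh
  | monomial n c =>
    obtain ⟨a, s, hs, h⟩ := mem_locOverring.1 c.2
    refine ⟨s, hs, Polynomial.monomial n (algebraMap D K a), fun x hx => ?_, ?_⟩
    · rw [Polynomial.eval_monomial]
      exact mul_mem (Subalgebra.algebraMap_mem _ a) (pow_mem hx n)
    · change (Polynomial.monomial n c).map (locAt K p).val.toRingHom = _
      rw [Polynomial.map_monomial, Polynomial.smul_monomial, smul_eq_mul, mul_comm]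
      exact congrArg _ h

end Localization

/-! ### Flat overrings and polynomial regularity -/

section Flat

variable {D : Type*} [CommRing D] [IsDomain D] {K : Type*} [Field K] [Algebra D K]
  [IsFractionRing D K]

/-- A flat overring is contained in the localization of `D` at the contraction of any of its
primes. -/
theorem mem_locAt_comap_of_flat (A : Subalgebra D K) [Module.Flat D A] (m : Ideal A) [m.IsPrime]
    (x : A) : (x : K) ∈ locAt K (m.comap (algebraMap D A)) := by
  obtain ⟨a, b, hb, hab⟩ := IsFractionRing.div_surjective (A := D) (x : K)
  have hb0 : algebraMap D K b ≠ 0 := IsFractionRing.to_map_ne_zero_of_mem_nonZeroDivisors hb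
  have hrel : b • x = a • (1 : A) := by
    apply Subtype.ext
    change b • (x : K) = a • (1 : K)
    rw [Algebra.smul_def, Algebra.smul_def, ← hab]
    field_simp
  -- The equational criterion for `b·x - a·1 = 0` writes `1 = ∑ c₁ⱼyⱼ` with `b c₀ⱼ = a c₁ⱼ`. Some
  -- `c₁ⱼ` avoids `m`, and then `x = c₀ⱼ/c₁ⱼ`.
  obtain ⟨k, c, y, hy, hc⟩ := Module.Flat.isTrivialRelation_of_sum_smul_eq_zero
    (R := D) (M := A) (f := ![b, -a]) (x := ![x, 1]) (by simp [Fin.sum_univ_two, hrel])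
  have h1 : (1 : A) = ∑ j, c 1 j • y j := hy 1
  obtain ⟨j, hj⟩ : ∃ j, algebraMap D A (c 1 j) ∉ m := by
    by_contra! hcon
    refine (Ideal.ne_top_iff_one m).1 (Ideal.IsPrime.ne_top inferInstance) ?_
    rw [h1]
    exact sum_mem fun j _ => by
      rw [Algebra.smul_def]
      exact m.mul_mem_right _ (hcon j)
  refine mem_locOverring.2 ⟨c 0 j, c 1 j, hj, ?_⟩
  have hj0 : algebraMap D K (c 1 j) ≠ 0 := by
    intro h0
    rw [map_eq_zero_iff _ (IsFractionRing.injective D K)] at h0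
    exact hj (by simp [h0])
  have := congrArg (algebraMap D K) (hc j)
  simp only [Fin.sum_univ_two, Matrix.cons_val_zero, Matrix.cons_val_one, map_add, map_mul,
    map_neg, map_zero] at this
  rw [← hab]
  field_simp
  linear_combination -this

theorem span_intRing_le_intOn (A : Subalgebra D K) :
    (Submodule.span A (IntRing (⊥ : Subalgebra D K) : Set K[X]) : Set K[X]) ⊆
      IntOn ((⊥ : Subalgebra D K) : Set K) A := by
  intro f hf
  induction hf using Submodule.span_induction with
  | mem f hf => exact fun a ha => (bot_le : (⊥ : Subalgebra D K) ≤ A) (hf a ha)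
  | zero => exact zero_mem _
  | add f g _ _ hf hg => exact add_mem hf hg
  | smul c f _ hf =>
    intro a ha
    have : (c • f).eval a = (c : K) * f.eval a := by
      rw [← Polynomial.eval_C_mul, ← Polynomial.smul_eq_C_mul]; rfl
    rw [this]
    exact mul_mem c.2 (hf a ha)

theorem isPolynomiallyRegular_of_flat (h : ∀ (p : Ideal D) [p.IsPrime], IntLocalizesAt K p)
    (A : Subalgebra D K) [Module.Flat D A] : IsPolynomiallyRegular A := by
  refine Set.Subset.antisymm (span_intRing_le_intOn A) fun f hf => ?_
  let N := Submodule.span A (IntRing (⊥ : Subalgebra D K) : Set K[X])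
  -- The conductor of `f` into the span.
  let I : Ideal A := N.comap (LinearMap.toSpanSingleton A K[X] f)
  have hI : ∀ c : A, c ∈ I ↔ c • f ∈ N := fun c => by simp [I]
  suffices hT : I = ⊤ by
    have := (hI 1).1 (by rw [hT]; trivial)
    rwa [one_smul] at this
  by_contra hne
  obtain ⟨m, hm, hle⟩ := Ideal.exists_le_maximal I hne
  have hf' : f ∈ IntRing (locAt K (m.comap (algebraMap D A))) := by
    rw [← intOn_bot_locOverring]
    exact fun a ha => mem_locAt_comap_of_flat A m ⟨_, hf a ha⟩
  obtain ⟨s, hs, hsf⟩ := (intLocalizesAt_iff _).1 (h (m.comap (algebraMap D A))) f hf'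
  refine hs (hle ((hI _).2 ?_))
  rw [algebraMap_smul]
  exact Submodule.subset_span hsf

theorem intRing_locOverring_of_isPolynomiallyRegular (S : Submonoid D) (hS : S ≤ D⁰)
    (h : IsPolynomiallyRegular (locOverring K S hS)) :
    IntRing (locOverring K S hS) = fractionsIn S hS (IntRing (⊥ : Subalgebra D K)) := by
  refine le_antisymm (fun f hf => ?_) (fractionsIn_le_intRing _ _)
  rw [← intOn_bot_locOverring, ← SetLike.mem_coe, ← (show _ = _ from h)] at hf
  replace hf : f ∈ Submodule.span (locOverring K S hS) _ := hf
  induction hf using Submodule.span_induction with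
  | mem f hf => exact ⟨1, S.one_mem, f, hf, by simp⟩
  | zero => exact zero_mem _
  | add f g _ _ hf hg => exact add_mem hf hg
  | smul c f _ hf =>
    obtain ⟨a, s, hs, hc⟩ := mem_locOverring.1 c.2
    obtain ⟨t, ht, g, hg, rfl⟩ := hf
    refine ⟨s * t, S.mul_mem hs ht, a • g, Subalgebra.smul_mem _ hg a, ?_⟩
    rw [← algebraMap_smul K a g, smul_smul, map_mul, mul_inv]
    change (c : K) • ((algebraMap D K t)⁻¹ • g) = _
    rw [hc, smul_smul]
    congr 1
    ring

end Flat

/-! ### Interpolation at an infinite residue ring -/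

section Interpolation

variable {D : Type*} [CommRing D] [IsDomain D] {K : Type*} [Field K] [Algebra D K]
  [IsFractionRing D K]

/-- Interpolating at points of `D` distinct modulo `q`, all denominators are products of differences
outside `q`, hence units of `D_q`. -/
theorem mem_range_mapAlgHom_of_infinite_quotient (q : Ideal D) [q.IsPrime] [Infinite (D ⧸ q)]
    {f : K[X]} (hf : f ∈ IntOn ((⊥ : Subalgebra D K) : Set K) (locAt K q)) :
    f ∈ (Polynomial.mapAlgHom (locAt K q).val).range := by
  let e := Infinite.natEmbedding (D ⧸ q)
  choose v hv using fun i => Ideal.Quotient.mk_surjective (e i)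
  have hvq : ∀ i j, i ≠ j → v i - v j ∉ q := by
    intro i j hij h
    rw [← Ideal.Quotient.eq, hv, hv] at h
    exact hij (e.injective h)
  have hC : ∀ x ∈ locAt K q, Polynomial.C x ∈ (Polynomial.mapAlgHom (locAt K q).val).range :=
    fun x hx => ⟨Polynomial.C ⟨x, hx⟩, Polynomial.map_C _⟩
  have hX : (Polynomial.X : K[X]) ∈ (Polynomial.mapAlgHom (locAt K q).val).range :=
    ⟨Polynomial.X, Polynomial.map_X _⟩
  have hinj : Function.Injective fun i => algebraMap D K (v i) := by
    intro i j hij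
    by_contra hne
    refine hvq i j hne ?_
    rw [IsFractionRing.injective D K hij, sub_self]
    exact q.zero_mem
  rw [Lagrange.eq_interpolate (f := f) (s := Finset.range (f.natDegree + 1)) hinj.injOn
    (by
      rw [Finset.card_range]
      exact (Polynomial.degree_le_natDegree).trans_lt (by exact_mod_cast Nat.lt_succ_self _)),
    Lagrange.interpolate_apply]
  refine sum_mem fun i _ => mul_mem (hC _ (hf _ (Subalgebra.algebraMap_mem _ _))) ?_
  refine prod_mem fun j hj => mul_mem (hC _ ?_) (sub_mem hX (hC _ (Subalgebra.algebraMap_mem _ _)))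
  rw [← map_sub]
  exact inv_mem_locOverring (hvq i j (Finset.ne_of_mem_erase hj).symm)

end Interpolation

section Annihilator

variable {R : Type*} [CommRing R] {K : Type*} [Field K] [Algebra R K]

theorem mem_annihilator_span_mk {c : K} {r : R} :
    r ∈ (Submodule.span R {(Submodule.Quotient.mk c : K ⧸ (1 : Submodule R K))}).annihilator ↔
      ∃ d : R, algebraMap R K d = algebraMap R K r * c := by
  rw [Submodule.mem_annihilator_span_singleton, ← Submodule.Quotient.mk_smul,
    Submodule.Quotient.mk_eq_zero, Submodule.mem_one, Algebra.smul_def]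

end Annihilator

/-! ### Weakly associated primes and `t`-ideals -/

section Local

variable {R : Type*} [CommRing R] [IsDomain R] {K : Type*} [Field K] [Algebra R K]
  [IsFractionRing R K]

/-- If a polynomial with a coefficient outside `R` is integer-valued on `R`, then the module `K / R`
has a weakly associated prime with finite residue ring. -/
theorem exists_isWeaklyAssociatedPrime_finite {f : K[X]} (hf : ∀ r : R, ∃ d : R,
    algebraMap R K d = f.eval (algebraMap R K r)) {n : ℕ}
    (hn : ∀ d : R, algebraMap R K d ≠ f.coeff n) :
    ∃ q : Ideal R, q.IsPrime ∧ IsWeaklyAssociatedPrime R (K ⧸ (1 : Submodule R K)) q ∧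
      Finite (R ⧸ q) := by
  -- Take `q` minimal over the denominator ideal of the bad coefficient. If `R ⧸ q` were infinite,
  -- interpolation would put that coefficient in `R_q`, giving it a denominator outside `q`.
  obtain ⟨q, hq⟩ := Ideal.nonempty_minimalPrimes
    (I := (Submodule.span R {(Submodule.Quotient.mk (f.coeff n) :
      K ⧸ (1 : Submodule R K))}).annihilator) (by
    rw [Ideal.ne_top_iff_one, mem_annihilator_span_mk]
    rintro ⟨d, hd⟩
    exact hn d (by simpa using hd))
  have hqp : q.IsPrime := hq.1.1
  refine ⟨q, hqp, ⟨_, hq⟩, ?_⟩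
  by_contra hinf
  rw [not_finite_iff_infinite] at hinf
  have hf' : f ∈ IntOn ((⊥ : Subalgebra R K) : Set K) (locAt K q) := by
    intro a ha
    obtain ⟨r, rfl⟩ := Algebra.mem_bot.1 ha
    obtain ⟨d, hd⟩ := hf r
    rw [← hd]
    exact Subalgebra.algebraMap_mem _ d
  obtain ⟨g, rfl⟩ := mem_range_mapAlgHom_of_infinite_quotient q hf'
  obtain ⟨a, s, hs, h⟩ := mem_locOverring.1 (g.coeff n).2
  have hs0 := algebraMap_ne_zero_of_mem (K := K) q.primeCompl_le_nonZeroDivisors hs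
  refine hs (hq.1.2 (mem_annihilator_span_mk.2 ⟨a, ?_⟩))
  have : (Polynomial.mapAlgHom (locAt K q).val g).coeff n = (g.coeff n : K) :=
    Polynomial.coeff_map _ n
  refine Eq.trans ?_ (congrArg _ this.symm)
  rw [h]
  field_simp

theorem subset_tClosure {I : FractionalIdeal R⁰ K} (hI : I ≠ 0) {x : K} (hx : x ∈ I) :
    x ∈ tClosure R K I := by
  have key : ∀ y ∈ I, y ≠ 0 → ∃ J : FractionalIdeal R⁰ K, J ≠ 0 ∧ (J : Submodule R K).FG ∧ J ≤ I ∧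
      y ∈ vClosure R K J := by
    intro y hy hy0
    refine ⟨FractionalIdeal.spanSingleton R⁰ y, FractionalIdeal.spanSingleton_ne_zero_iff.2 hy0,
      ?_, FractionalIdeal.spanSingleton_le_iff_mem.2 hy, ?_⟩
    · rw [FractionalIdeal.coe_spanSingleton]
      exact Submodule.fg_span_singleton y
    · rw [vClosure, FractionalIdeal.spanSingleton_inv, FractionalIdeal.spanSingleton_inv, inv_inv]
      exact FractionalIdeal.mem_spanSingleton_self _ _
  -- The zero ideal is not an admissible `J`, so `0` needs a principal ideal on some nonzero element
  -- of `I`.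
  by_cases hx0 : x = 0
  · obtain ⟨y, hy, hyI⟩ : ∃ y : K, y ≠ 0 ∧ y ∈ I := by
      by_contra! hcon
      refine hI (FractionalIdeal.eq_zero_iff.2 fun y hy => ?_)
      by_contra h0
      exact hcon y h0 hy
    obtain ⟨J, h1, h2, h3, -⟩ := key y hyI hy
    exact ⟨J, h1, h2, h3, by rw [hx0]; exact (vClosure R K J : Submodule R K).zero_mem⟩
  · exact key x hx hx0

theorem inv_ne_zero_of_ne_zero {J : FractionalIdeal R⁰ K} (hJ : J ≠ 0) : J⁻¹ ≠ 0 :=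
  fun h => (FractionalIdeal.bot_lt_mul_inv hJ).ne (by rw [h, mul_zero]; rfl)

theorem mem_vClosure {J : FractionalIdeal R⁰ K} (hJ : J ≠ 0) {x : K} :
    x ∈ vClosure R K J ↔
      ∀ y : K, (∀ z ∈ J, y * z ∈ (1 : FractionalIdeal R⁰ K)) →
        x * y ∈ (1 : FractionalIdeal R⁰ K) := by
  rw [vClosure, FractionalIdeal.mem_inv_iff (inv_ne_zero_of_ne_zero hJ)]
  simp only [FractionalIdeal.mem_inv_iff hJ]

/-- Since `J ⊆ R` gives `1 ∈ J⁻¹`, also `J_v ⊆ R`, so only elements of `R` need testing. -/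
theorem isTIdeal_of_vClosure_le {I : Ideal R} (hI : I ≠ ⊥)
    (h : ∀ J : FractionalIdeal R⁰ K, J ≠ 0 → (J : Submodule R K).FG →
      J ≤ (I : FractionalIdeal R⁰ K) → ∀ x : R, algebraMap R K x ∈ vClosure R K J → x ∈ I) :
    IsTIdeal R K I := by
  have hI' : (I : FractionalIdeal R⁰ K) ≠ 0 := FractionalIdeal.coeIdeal_ne_zero.2 hI
  refine ⟨hI', Set.Subset.antisymm ?_ fun x hx => subset_tClosure hI' hx⟩
  rintro x ⟨J, hJ, hfg, hle, hx⟩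
  have hx1 := (mem_vClosure hJ).1 hx 1 fun z hz => by
    rw [one_mul]
    exact FractionalIdeal.coeIdeal_le_one (hle hz)
  rw [mul_one] at hx1
  obtain ⟨r, rfl⟩ := (FractionalIdeal.mem_one_iff _).1 hx1
  exact FractionalIdeal.mem_coeIdeal_of_mem _ (h J hJ hfg hle r hx)

theorem isTIdeal_maximalIdeal [IsLocalRing R]
    (h : IsWeaklyAssociatedPrime R (K ⧸ (1 : Submodule R K)) (IsLocalRing.maximalIdeal R)) :
    IsTIdeal R K (IsLocalRing.maximalIdeal R) := by
  obtain ⟨m, hm⟩ := h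
  obtain ⟨c, rfl⟩ := Submodule.Quotient.mk_surjective _ m
  set I := (Submodule.span R {(Submodule.Quotient.mk c : K ⧸ (1 : Submodule R K))}).annihilator
    with hIdef
  have hc : ∀ d : R, algebraMap R K d ≠ c := by
    intro d hd
    refine (Ideal.ne_top_iff_one _).1 hm.1.1.ne_top (hm.1.2 (mem_annihilator_span_mk.2 ⟨d, ?_⟩))
    rw [hd, map_one, one_mul]
  -- Minimality over `I` makes the maximal ideal the only prime containing `I`.
  have hrad : IsLocalRing.maximalIdeal R ≤ I.radical := by
    rw [Ideal.radical_eq_sInf]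
    refine le_sInf fun P hP => hm.2 ⟨hP.2, hP.1⟩ ?_
    exact IsLocalRing.le_maximalIdeal hP.2.ne_top
  refine isTIdeal_of_vClosure_le ?_ ?_
  · intro hbot
    obtain ⟨a, b, hb, rfl⟩ := IsFractionRing.div_surjective (A := R) c
    have hb0 : algebraMap R K b ≠ 0 := IsFractionRing.to_map_ne_zero_of_mem_nonZeroDivisors hb
    have hbI : b ∈ I := mem_annihilator_span_mk.2 ⟨a, by field_simp⟩
    have := hm.1.2 hbI
    rw [hbot, Ideal.mem_bot] at this
    exact hb0 (by rw [this, map_zero])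
  · intro J hJ hfg hle x hx
    by_contra hxm
    have hxu : IsUnit x := by
      by_contra hxu
      exact hxm ((IsLocalRing.mem_maximalIdeal x).2 hxu)
    -- the integral ideal underlying `J`
    let J' : Ideal R := (J : Submodule R K).comap (Algebra.linearMap R K)
    have hJJ' : ∀ z ∈ J, ∃ r ∈ J', algebraMap R K r = z := by
      intro z hz
      obtain ⟨r, -, rfl⟩ := (FractionalIdeal.mem_coeIdeal _).1 (hle hz)
      exact ⟨r, hz, rfl⟩
    have hJm : J' ≤ I.radical := by
      intro r hr
      obtain ⟨r', hr', h⟩ := (FractionalIdeal.mem_coeIdeal _).1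
        (hle (show algebraMap R K r ∈ J from hr))
      rw [IsFractionRing.injective R K h] at hr'
      exact hrad hr'
    have hJfg : J'.FG := by
      have hmap : Submodule.map (Algebra.linearMap R K) J' = (J : Submodule R K) := by
        refine le_antisymm (Submodule.map_comap_le _ _) fun z hz => ?_
        obtain ⟨r, hr, rfl⟩ := hJJ' z hz
        exact ⟨r, hr, rfl⟩
      refine Submodule.fg_of_fg_map_injective (Algebra.linearMap R K) (IsFractionRing.injective R K) ?_
      rw [hmap]
      exact hfg
    obtain ⟨n, hn⟩ := Ideal.exists_pow_le_of_le_radical_of_fg hJm hJfg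
    -- `x ∈ J_v` is a unit, so `(R :_K J) = R`; descend along the powers of `J`
    have hdesc : ∀ k : ℕ, J' ^ k ≤ I → False := by
      intro k
      induction k with
      | zero =>
        intro h1
        rw [pow_zero, Ideal.one_eq_top] at h1
        exact (Ideal.ne_top_iff_one _).1 hm.1.1.ne_top (hm.1.2 (h1 trivial))
      | succ k ih =>
        intro hk
        -- For `r ∈ J'ᵏ`, `rcJ ⊆ R`, so `xrc ∈ R` and the unit `x` cancels. At `k = 0` this puts `1`
        -- in `I`.
        refine ih fun r hr => mem_annihilator_span_mk.2 ?_
        have := (mem_vClosure hJ).1 hx (algebraMap R K r * c) fun z hz => by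
          obtain ⟨j, hj, rfl⟩ := hJJ' z hz
          obtain ⟨d, hd⟩ := mem_annihilator_span_mk.1
            (hk (pow_succ J' k ▸ Ideal.mul_mem_mul hr hj))
          exact (FractionalIdeal.mem_one_iff _).2 ⟨d, by rw [hd, map_mul]; ring⟩
        obtain ⟨d, hd⟩ := (FractionalIdeal.mem_one_iff _).1 this
        obtain ⟨u, rfl⟩ := hxu
        refine ⟨↑u⁻¹ * d, ?_⟩
        rw [map_mul, hd, ← mul_assoc, ← map_mul, Units.inv_mul, map_one, one_mul]
    exact hdesc n hn

end Local

/-! ### Descent to `D` and weak int primes -/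

section Global

variable {D : Type*} [CommRing D] [IsDomain D] {K : Type*} [Field K] [Algebra D K]
  [IsFractionRing D K]

theorem algebraMap_mem_primeAt (p : Ideal D) [p.IsPrime] {d : D} :
    algebraMap D (locAt K p) d ∈ primeAt K p ↔ d ∈ p := by
  have := IsLocalization.under_map_of_isPrime_disjoint p.primeCompl (locAt K p)
    (I := p) inferInstance (by
      rw [Set.disjoint_left]; exact fun x hx hx' => hx hx')
  exact (Ideal.mem_comap (K := primeAt K p)).symm.trans (by rw [← Ideal.under_def, this])

theorem isTIdeal_of_isTLocalizing (p : Ideal D) [p.IsPrime] (h : IsTLocalizing K p) :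
    IsTIdeal D K p := by
  obtain ⟨h0, ht⟩ := h
  refine isTIdeal_of_vClosure_le ?_ ?_
  · rintro rfl
    exact h0 (by rw [primeAt, Ideal.map_bot]; exact FractionalIdeal.coeIdeal_bot)
  · intro J hJ hfg hle x hx
    rw [← algebraMap_mem_primeAt (K := K) p]
    classical
    obtain ⟨T, hT⟩ := hfg
    have hTJ : ∀ z ∈ T, z ∈ J := fun z hz => by
      change z ∈ (J : Submodule D K)
      rw [← hT]
      exact Submodule.subset_span hz
    have hM : (Submodule.span (locAt K p) (T : Set K)).FG := ⟨T, rfl⟩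
    let J' : FractionalIdeal (locAt K p)⁰ K := ⟨_, FractionalIdeal.isFractional_of_fg hM⟩
    have hJJ' : ∀ z ∈ J, z ∈ J' := by
      intro z hz
      change z ∈ (J : Submodule D K) at hz
      rw [← hT] at hz
      exact Submodule.span_le_restrictScalars D (locAt K p) _ hz
    have hJ'0 : J' ≠ 0 := by
      intro h0
      refine hJ (FractionalIdeal.eq_zero_iff.2 fun z hz => ?_)
      exact FractionalIdeal.eq_zero_iff.1 h0 z (hJJ' z hz)
    have hJ'le : J' ≤ (primeAt K p : FractionalIdeal (locAt K p)⁰ K) := by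
      refine Submodule.span_le.2 fun z hz => ?_
      obtain ⟨d, hd, rfl⟩ := (FractionalIdeal.mem_coeIdeal _).1 (hle (hTJ z hz))
      exact (FractionalIdeal.mem_coeIdeal _).2
        ⟨algebraMap D _ d, (algebraMap_mem_primeAt p).2 hd, rfl⟩
    have hxt : algebraMap D K x ∈ tClosure (locAt K p) K (primeAt K p) := by
      refine ⟨J', hJ'0, hM, hJ'le, (mem_vClosure hJ'0).2 fun y hy => ?_⟩
      -- A common denominator `s` for `y` times the finitely many generators gives `syJ ⊆ D`, hence
      -- `xsy ∈ D` and `xy ∈ D_p`.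
      have hs : ∀ U : Finset K, (∀ z ∈ U, z ∈ J') → ∃ s ∉ p, ∀ z ∈ U, ∃ d : D,
          algebraMap D K d = algebraMap D K s * y * z := by
        intro U
        induction U using Finset.induction_on with
        | empty => exact fun _ => ⟨1, (Ideal.ne_top_iff_one p).1 (Ideal.IsPrime.ne_top'), by simp⟩
        | insert z U _ ih =>
          intro hU
          obtain ⟨s, hs, hsU⟩ := ih fun w hw => hU w (Finset.mem_insert_of_mem hw)
          obtain ⟨r, hr⟩ := (FractionalIdeal.mem_one_iff _).1
            (hy z (hU z (Finset.mem_insert_self _ _)))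
          obtain ⟨a, t, ht, hat⟩ := mem_locOverring.1 r.2
          have ht0 := algebraMap_ne_zero_of_mem (K := K) p.primeCompl_le_nonZeroDivisors ht
          have hyz : y * z = algebraMap D K a * (algebraMap D K t)⁻¹ := by rw [← hr, ← hat]; rfl
          refine ⟨s * t, p.primeCompl.mul_mem hs ht, fun w hw => ?_⟩
          rcases Finset.mem_insert.1 hw with rfl | hw
          · refine ⟨s * a, ?_⟩
            rw [map_mul, map_mul, mul_assoc (_ * _) y, hyz]
            field_simp
          · obtain ⟨d, hd⟩ := hsU w hw
            exact ⟨t * d, by rw [map_mul, map_mul, hd]; ring⟩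
      obtain ⟨s, hs, hsT⟩ := hs T fun z hz => hJJ' z (hTJ z hz)
      have hs0 := algebraMap_ne_zero_of_mem (K := K) p.primeCompl_le_nonZeroDivisors
        (show s ∈ p.primeCompl from hs)
      have hxs := (mem_vClosure hJ).1 hx (algebraMap D K s * y) fun z hz => by
        change z ∈ (J : Submodule D K) at hz
        rw [← hT] at hz
        induction hz using Submodule.span_induction with
        | mem z hz =>
          obtain ⟨d, hd⟩ := hsT z hz
          exact (FractionalIdeal.mem_one_iff _).2 ⟨d, hd⟩
        | zero => rw [mul_zero]; exact ((1 : FractionalIdeal D⁰ K) : Submodule D K).zero_mem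
        | add z w _ _ hz hw => rw [mul_add]; exact ((1 : FractionalIdeal D⁰ K) : Submodule D K).add_mem hz hw
        | smul d z _ hz =>
          rw [mul_smul_comm]
          exact Submodule.smul_mem ((1 : FractionalIdeal D⁰ K) : Submodule D K) d hz
      obtain ⟨d, hd⟩ := (FractionalIdeal.mem_one_iff _).1 hxs
      refine (FractionalIdeal.mem_one_iff _).2
        ⟨⟨_, mem_locOverring.2 ⟨d, s, hs, rfl⟩⟩, ?_⟩
      change algebraMap D K d * (algebraMap D K s)⁻¹ = _
      rw [hd]
      field_simp
    rw [ht] at hxt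
    obtain ⟨r, hr, hrx⟩ := (FractionalIdeal.mem_coeIdeal _).1 hxt
    have : r = algebraMap D (locAt K p) x := Subtype.ext hrx
    rwa [← this]

theorem isTMaximal_of_isTIdeal {p : Ideal D} (hp : p.IsMaximal) (h : IsTIdeal D K p) :
    IsTMaximal D K p :=
  ⟨⟨h, hp.ne_top⟩, fun _ hJ hle => (hp.eq_of_le hJ.2 hle).ge⟩

/-- A weak int prime is a maximal ideal with finite residue field whose extension to `D_𝔭` is a
weakly associated prime of `K / D_𝔭`. -/
theorem IsWeakIntPrime.isWeaklyAssociatedPrime {p : Ideal D} [p.IsPrime]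
    (h : IsWeakIntPrime K p) :
    IsWeaklyAssociatedPrime (locAt K p) (K ⧸ (1 : Submodule (locAt K p) K)) (primeAt K p) ∧
      p.IsMaximal ∧ Finite p.ResidueField := by
  obtain ⟨f, hf, hfn⟩ : ∃ f ∈ IntRing (locAt K p),
      f ∉ (Polynomial.mapAlgHom (locAt K p).val).range := by
    by_contra! hcon
    exact h (le_antisymm hcon (range_mapAlgHom_le_intRing _))
  obtain ⟨n, hn⟩ : ∃ n, f.coeff n ∉ locAt K p := by
    by_contra! hcon
    refine hfn ?_
    rw [← Polynomial.sum_monomial_eq f]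
    exact sum_mem fun n _ => ⟨Polynomial.monomial n ⟨_, hcon n⟩, Polynomial.map_monomial _⟩
  obtain ⟨q, hq, hqw, hqf⟩ := exists_isWeaklyAssociatedPrime_finite (R := locAt K p) (f := f)
    (n := n) (fun r => ⟨⟨_, hf _ r.2⟩, rfl⟩) (fun d hd => hn (hd ▸ d.2))
  have : IsLocalRing (locAt K p) := IsLocalization.AtPrime.isLocalRing _ p
  -- A finite domain is a field, so `q` is the maximal ideal of the local ring `D_p`.
  have hqm : q = primeAt K p := by
    have : q.IsMaximal :=
      Ideal.Quotient.maximal_of_isField _ (Finite.isField_of_domain (locAt K p ⧸ q))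
    rw [IsLocalRing.eq_maximalIdeal this]
    exact (IsLocalization.AtPrime.map_eq_maximalIdeal p (locAt K p)).symm
  subst hqm
  have hfin : Finite (D ⧸ p) := by
    refine Finite.of_injective (Ideal.quotientMap (primeAt K p) (algebraMap D (locAt K p))
      Ideal.le_comap_map) (Ideal.quotientMap_injective' fun d hd => ?_)
    exact (algebraMap_mem_primeAt p).1 hd
  have hmax : p.IsMaximal :=
    Ideal.Quotient.maximal_of_isField _ (Finite.isField_of_domain (D ⧸ p))
  exact ⟨hqw, hmax, Finite.of_surjective _ p.bijective_algebraMap_quotient_residueField.surjective⟩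

theorem isTLocalizing_of_isWeaklyAssociatedPrime (p : Ideal D) [p.IsPrime]
    (h : IsWeaklyAssociatedPrime (locAt K p) (K ⧸ (1 : Submodule (locAt K p) K)) (primeAt K p)) :
    IsTLocalizing K p := by
  have : IsLocalRing (locAt K p) := IsLocalization.AtPrime.isLocalRing _ p
  have e : primeAt K p = IsLocalRing.maximalIdeal (locAt K p) :=
    IsLocalization.AtPrime.map_eq_maximalIdeal p (locAt K p)
  rw [IsTLocalizing, e]
  exact isTIdeal_maximalIdeal (e ▸ h)

end Global

end IntPoly

theorem proposition2p3 (D : Type*) [CommRing D] [IsDomain D] (K : Type*) [Field K] [Algebra D K]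
    [IsFractionRing D K] :
    List.TFAE [
      ∀ A : Subalgebra D K, Module.Flat D A → IntPoly.IsPolynomiallyRegular A,
      ∀ (S : Submonoid D) (hS : S ≤ nonZeroDivisors D),
        IntPoly.IntRing (IntPoly.locOverring K S hS) =
          IntPoly.fractionsIn S hS (IntPoly.IntRing (⊥ : Subalgebra D K)),
      ∀ (p : Ideal D) [p.IsPrime], IntPoly.IntLocalizesAt K p,
      ∀ (p : Ideal D) [p.IsPrime], IntPoly.IsTLocalizing K p → IntPoly.IsTMaximal D K p →
        Finite p.ResidueField → IntPoly.IntLocalizesAt K p,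
      ∀ (p : Ideal D) [p.IsPrime],
        IntPoly.IsWeaklyAssociatedPrime (IntPoly.locAt K p)
          (K ⧸ (1 : Submodule (IntPoly.locAt K p) K)) (IntPoly.primeAt K p) →
        Finite p.ResidueField → IntPoly.IntLocalizesAt K p,
      ∀ (p : Ideal D) [p.IsPrime], IntPoly.IsWeakIntPrime K p → IntPoly.IntLocalizesAt K p] := by
  tfae_have 1 → 2 := fun h S hS =>
    IntPoly.intRing_locOverring_of_isPolynomiallyRegular S hS (h _ (IsLocalization.flat _ S))
  tfae_have 2 → 3 := fun h p _ => h p.primeCompl p.primeCompl_le_nonZeroDivisors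
  tfae_have 3 → 1 := fun h A _ => IntPoly.isPolynomiallyRegular_of_flat h A
  tfae_have 3 → 4 := fun h p _ _ _ _ => h p
  tfae_have 3 → 5 := fun h p _ _ _ => h p
  tfae_have 5 → 6 := fun h p _ hp =>
    h p hp.isWeaklyAssociatedPrime.1 hp.isWeaklyAssociatedPrime.2.2
  tfae_have 4 → 6 := fun h p _ hp => by
    obtain ⟨hw, hmax, hfin⟩ := hp.isWeaklyAssociatedPrime
    have ht := IntPoly.isTLocalizing_of_isWeaklyAssociatedPrime p hw
    exact h p ht (IntPoly.isTMaximal_of_isTIdeal hmax (IntPoly.isTIdeal_of_isTLocalizing p ht)) hfin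
  tfae_have 6 → 3 := fun h p _ => by
    by_cases hp : IntPoly.IsWeakIntPrime K p
    · exact h p hp
    · exact IntPoly.intLocalizesAt_of_not_isWeakIntPrime p hp
  tfae_finish
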